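/- Let $U=(X,Z,Y)$ have law $P$ on $\mathbb{R}^g\times\mathbb{R}^h\times\mathbb{R}$, with $\mathbb{E}[X_i^2]<\infty$ and $\mathbb{E}[Z_j^2]<\infty$ for all $i,j$ and $\mathbb{E}[Y^4]<\infty$. Put $\rho(X,Z_j)=\sum_{i=1}^g|\rho(X_i,Z_j)|$, where $\rho(X_i,Z_j)$ is the Pearson correlation (taken to be $0$ if one of the two variances vanishes). Let $t\in\mathbb{R}$ be such that $\rho(X,Z_j)\neq t$ for every $j$, let $V=(Z_j:\ \rho(X,Z_j)\le t)$, and define $$\mu(x,v)=\mathbb{E}[Y\mid X=x,V=v],\qquad \mu(v)=\mathbb{E}[Y\mid V=v],\qquad \psi_1=\mathbb{E}\big[(\mu(X,V)-\mu(V))^2\big].$$ Let $U_1,U_2,\ldots$ be i.i.d. with law $P$. For each $n$ split the first $m_n+n$ observations into a training sample $\mathcal{D}_0=\{U_1,\ldots,U_{m_n}\}$ and an evaluation sample $\mathcal{D}_1=\{U_{m_n+1},\ldots,U_{m_n+n}\}$, where $m_n\to\infty$. Let $\hat\rho(X,Z_j)$ be the version of $\rho(X,Z_j)$ computed from $\mathcal{D}_0$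 with sample Pearson correlations (with the same convention), and let $\hat V=(Z_j:\ \hat\rho(X,Z_j)\le t)$. For every subvector $V'$ of $Z$ let regression estimators of $(x,v')\mapsto\mathbb{E}[Y\mid X=x,V'=v']$ and of $v'\mapsto\mathbb{E}[Y\mid V'=v']$ be given that are computed from $\mathcal{D}_0$ (and are jointly measurable in the sample and the argument). Write $\hat\mu(x,v)$ and $\hat\mu(v)$ for those belonging to $V'=V$, write $\hat\mu(x,\hat v)$ and $\hat\mu(\hat v)$ for those belonging to $V'=\hat V$, and define $$\hat\psi_1=\frac1n\sum_{i\in\mathcal{D}_1}\big(Y_i-\hat\mu(\hat V_i)\big)^2-\frac1n\sum_{i\in\mathcal{D}_1}\big(Y_i-\hat\mu(X_i,\hat V_i)\big)^2 .$$ Suppose that $\|\hat\mu(x,v)-\mu(x,v)\|=o_P(n^{-1/4})$ and $\|\hat\mu(v)-\mu(v)\|=o_P(n^{-1/4})$, where $\|\cdot\|$ is the $L^2(P)$ norm, and that $\psi_1\neq0$. Then $$\sqrt n\,(\hat\psi_1-\psi_1)\rightsquigarrow N(0,\tau^2),\qquad \tau^2=\mathrm{Var}\big[(Y-\mu(V))^2-(Y-\mu(X,V))^2\big],$$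 where $N(0,0)$ is the point mass at $0$. Moreover $\tau^2>0$ unless $Y=\mu(X,V)$ almost surely. -/

import Mathlib

open MeasureTheory ProbabilityTheory Filter Topology

namespace LOCO

noncomputable section

/-- One observation `u = (x, z, y)`, with `x ∈ ℝ^g`, `z ∈ ℝ^h` and `y ∈ ℝ`. -/
abbrev Obs (g h : ℕ) : Type := (Fin g → ℝ) × (Fin h → ℝ) × ℝ

variable {g h : ℕ}

/-- The covariates whose importance is assessed. -/
def Obs.X (u : Obs g h) : Fin g → ℝ := u.1

/-- The other covariates. -/
def Obs.Z (u : Obs g h) : Fin h → ℝ := u.2.1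

/-- The response. -/
def Obs.Y (u : Obs g h) : ℝ := u.2.2

/-- The subvector `(z_j : j ∈ S)` of `z`. -/
def Obs.V (S : Finset (Fin h)) (u : Obs g h) : S → ℝ := fun j => Obs.Z u j

/-! ### Screening -/

/-- Pearson correlation of two real random variables (`0` if one of the variances is `0`). -/
def pearson {Ω : Type*} [MeasurableSpace Ω] (A B : Ω → ℝ) (P : Measure Ω) : ℝ :=
  covariance A B P / (√(variance A P) * √(variance B P))

/-- Mean of a finite sample. -/
def sampleMean {m : ℕ} (a : Fin m → ℝ) : ℝ := (∑ i, a i) / m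

/-- Pearson correlation of a finite sample of pairs (`0` if one of the samples is constant). -/
def samplePearson {m : ℕ} (a b : Fin m → ℝ) : ℝ :=
  (∑ i, (a i - sampleMean a) * (b i - sampleMean b)) /
    (√(∑ i, (a i - sampleMean a) ^ 2) * √(∑ i, (b i - sampleMean b) ^ 2))

/-- The dependence measure `ρ(X, Z_j) = ∑ i, |ρ(X_i, Z_j)|`. -/
def rho (P : Measure (Obs g h)) (j : Fin h) : ℝ :=
  ∑ i : Fin g, |pearson (fun u => Obs.X u i) (fun u => Obs.Z u j) P|

/-- The sample version of `ρ(X, Z_j)`. -/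
def rhoHat {m : ℕ} (D : Fin m → Obs g h) (j : Fin h) : ℝ :=
  ∑ i : Fin g, |samplePearson (fun k => Obs.X (D k) i) (fun k => Obs.Z (D k) j)|

/-- The indices `j` of the `Z_j` that are kept: those with `ρ(X, Z_j) ≤ t`. -/
def screened (P : Measure (Obs g h)) (t : ℝ) : Finset (Fin h) :=
  Finset.univ.filter fun j => rho P j ≤ t

/-- The indices that are kept according to the sample `D`. -/
def screenedHat {m : ℕ} (D : Fin m → Obs g h) (t : ℝ) : Finset (Fin h) :=
  Finset.univ.filter fun j => rhoHat D j ≤ t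

/-! ### Regression functions and the parameter -/

/-- `μ(X, V) = E[Y | X, V]` with `V = (Z_j : j ∈ S)`, as a random variable on the space of
observations. -/
def regXV (P : Measure (Obs g h)) (S : Finset (Fin h)) : Obs g h → ℝ :=
  condExp (MeasurableSpace.comap (fun u : Obs g h => (Obs.X u, Obs.V S u)) inferInstance) P Obs.Y

/-- `μ(V) = E[Y | V]` with `V = (Z_j : j ∈ S)`. -/
def regV (P : Measure (Obs g h)) (S : Finset (Fin h)) : Obs g h → ℝ :=
  condExp (MeasurableSpace.comap (fun u : Obs g h => Obs.V S u) inferInstance) P Obs.Y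

/-- `ψ₁ = E[(μ(X, V) - μ(V))²]`, where `V` is the screened subvector of `Z`. -/
def psi1 (P : Measure (Obs g h)) (t : ℝ) : ℝ :=
  ∫ u, (regXV P (screened P t) u - regV P (screened P t) u) ^ 2 ∂P

/-- The asymptotic variance `τ² = Var[(Y - μ(V))² - (Y - μ(X, V))²]`. -/
def tauSq (P : Measure (Obs g h)) (t : ℝ) : ℝ :=
  variance (fun u => (Obs.Y u - regV P (screened P t) u) ^ 2
    - (Obs.Y u - regXV P (screened P t) u) ^ 2) P

/-! ### Estimation with sample splitting -/

/-- A regression method with training samples of size `m`: for every set `S` of retained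
indices, it turns a training sample into an estimate of `(x, v) ↦ E[Y | X = x, V = v]` and an
estimate of `v ↦ E[Y | V = v]`, where `V = (Z_j : j ∈ S)`. -/
structure RegMethod (g h m : ℕ) where
  muXV : (S : Finset (Fin h)) → (Fin m → Obs g h) → (Fin g → ℝ) → (S → ℝ) → ℝ
  muV : (S : Finset (Fin h)) → (Fin m → Obs g h) → (S → ℝ) → ℝ
  measurable_muXV : ∀ S : Finset (Fin h), Measurable
    fun p : (Fin m → Obs g h) × (Fin g → ℝ) × (S → ℝ) => muXV S p.1 p.2.1 p.2.2
  measurable_muV : ∀ S : Finset (Fin h), Measurable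
    fun p : (Fin m → Obs g h) × (S → ℝ) => muV S p.1 p.2

/-- `‖μ̂(x, v) - μ(x, v)‖` in `L²(P)`, for the training sample `D`. -/
def errXV {m : ℕ} (M : RegMethod g h m) (P : Measure (Obs g h)) (S : Finset (Fin h))
    (D : Fin m → Obs g h) : ENNReal :=
  eLpNorm (fun u => M.muXV S D (Obs.X u) (Obs.V S u) - regXV P S u) 2 P

/-- `‖μ̂(v) - μ(v)‖` in `L²(P)`, for the training sample `D`. -/
def errV {m : ℕ} (M : RegMethod g h m) (P : Measure (Obs g h)) (S : Finset (Fin h))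
    (D : Fin m → Obs g h) : ENNReal :=
  eLpNorm (fun u => M.muV S D (Obs.V S u) - regV P S u) 2 P

/-- The estimator `ψ̂₁`: the set `V̂` and the regression functions are estimated from the
training sample `D₀`, and the averages are over the evaluation sample `D₁`. -/
def psi1Hat {m n : ℕ} (M : RegMethod g h m) (t : ℝ) (D₀ : Fin m → Obs g h)
    (D₁ : Fin n → Obs g h) : ℝ :=
  (∑ i, (Obs.Y (D₁ i) - M.muV (screenedHat D₀ t) D₀ (Obs.V (screenedHat D₀ t) (D₁ i))) ^ 2) / n
  - (∑ i, (Obs.Y (D₁ i) - M.muXV (screenedHat D₀ t) D₀ (Obs.X (D₁ i))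
      (Obs.V (screenedHat D₀ t) (D₁ i))) ^ 2) / n

/-- `D₀` : the first `m` observations. -/
def trainSample {Ω : Type*} (U : ℕ → Ω → Obs g h) (m : ℕ) (ω : Ω) : Fin m → Obs g h :=
  fun i => U i ω

/-- `D₁` : the next `n` observations after the first `m`. -/
def evalSample {Ω : Type*} (U : ℕ → Ω → Obs g h) (m n : ℕ) (ω : Ω) : Fin n → Obs g h :=
  fun i => U (m + i) ω

/-- `W n = o_P(r n)` for nonnegative, possibly infinite, random quantities `W n`. -/
def IsLittleOP {Ω : Type*} [MeasurableSpace Ω] (Pr : Measure Ω) (W : ℕ → Ω → ENNReal)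
    (r : ℕ → ℝ) : Prop :=
  ∀ ε : ℝ, 0 < ε →
    Tendsto (fun n => Pr {ω | ENNReal.ofReal (ε * r n) < W n ω}) atTop (𝓝 0)

end

end LOCO

/-! With probability tending to one the screening picks the true `V`: finitely many sample
correlations converge almost surely, and no limit equals `t`. On that event `√n (ψ̂₁ - ψ₁)` is a
centred normalised sum of `W = (Y - μ(V))² - (Y - μ(X,V))²` over the evaluation sample, plus the
scaled excess empirical risk of `μ̂(v)`, minus that of `μ̂(x,v)`. Orthogonality of residuals gives
`E W = ψ₁`, so the sum obeys the central limit theorem; by Slutsky it remains to show that each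
excess risk vanishes in probability (`tendstoInMeasure_excess_risk`).

Let `A = E[Y | 𝓜]` and let `f` be its estimate, fixed once the training sample is conditioned on.
Then `(Y - f)² - (Y - A)² = (A - f)² + 2 (A - f)(Y - A)`. The square is handled by Markov's
inequality, since `√n ‖A - f‖²` is small. The cross term has mean zero but need not have a second
moment, because `Var(Y | 𝓜)` may be unbounded. It is therefore truncated to `Var(Y | 𝓜) ≤ √n`: this
event is in `𝓜`, so the mean stays zero, and the second moment is at most `√n ‖A - f‖²`, as
Chebyshev's inequality requires. The truncation matters with probability at most `n P(Var(Y | 𝓜) >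
√n)`, which tends to zero because `Y ∈ L⁴` puts `Var(Y | 𝓜)` in `L²`. -/

namespace LOCO

/-! ### Sums over a product measure -/

section Pi

variable {E : Type*} {mE : MeasurableSpace E} {P : Measure E} [IsProbabilityMeasure P] {n : ℕ}

theorem pi_exists_mem_le (T : Set E) (hT : MeasurableSet T) :
    Measure.pi (fun _ : Fin n => P) {x | ∃ i, x i ∈ T} ≤ n * P T := by
  have : {x : Fin n → E | ∃ i, x i ∈ T} = ⋃ i, (fun x : Fin n → E => x i) ⁻¹' T := by
    ext; simp
  rw [this]
  refine (measure_iUnion_fintype_le _ _).trans ?_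
  have (i : Fin n) : Measure.pi (fun _ : Fin n => P) ((fun x : Fin n → E => x i) ⁻¹' T) = P T :=
    (measurePreserving_eval (fun _ : Fin n => P) i).measure_preimage hT.nullMeasurableSet
  simp [this]

theorem pi_le_sum_le {f : E → ℝ} (hf : Integrable f P) (hf0 : ∀ x, 0 ≤ f x) {a : ℝ} (ha : 0 < a) :
    Measure.pi (fun _ : Fin n => P) {x | a ≤ ∑ i, f (x i)}
      ≤ ENNReal.ofReal (n * (∫ u, f u ∂P) / a) := by
  have hi (i : Fin n) : Integrable (fun x : Fin n → E => f (x i)) (Measure.pi fun _ => P) :=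
    (measurePreserving_eval (fun _ : Fin n => P) i).integrable_comp_of_integrable hf
  have h := mul_meas_ge_le_integral_of_nonneg (μ := Measure.pi fun _ : Fin n => P)
    (f := fun x => ∑ i, f (x i)) (ae_of_all _ fun x => Finset.sum_nonneg fun i _ => hf0 _)
    (integrable_finsetSum _ fun i _ => hi i) a
  have he (i : Fin n) : ∫ x : Fin n → E, f (x i) ∂(Measure.pi fun _ => P) = ∫ u, f u ∂P := by
    exact integral_comp_eval (μ := fun _ : Fin n => P) hf.1
  rw [integral_finsetSum _ fun i _ => hi i] at h
  simp only [he, Finset.sum_const, Finset.card_univ, Fintype.card_fin, nsmul_eq_mul] at h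
  rw [← ofReal_measureReal]
  refine ENNReal.ofReal_le_ofReal ?_
  rw [le_div_iff₀ ha, mul_comm]
  exact h

theorem pi_le_abs_sum_le {f : E → ℝ} (hf : MemLp f 2 P) (hf0 : ∫ u, f u ∂P = 0)
    {a : ℝ} (ha : 0 < a) :
    Measure.pi (fun _ : Fin n => P) {x | a ≤ |∑ i, f (x i)|}
      ≤ ENNReal.ofReal (n * (∫ u, f u ^ 2 ∂P) / a ^ 2) := by
  have hm (i : Fin n) : MemLp (fun x : Fin n → E => f (x i)) 2 (Measure.pi fun _ => P) :=
    hf.comp_measurePreserving (measurePreserving_eval (fun _ : Fin n => P) i)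
  have he (i : Fin n) : ∫ x : Fin n → E, f (x i) ∂(Measure.pi fun _ => P) = 0 := by
    rw [← hf0]
    exact integral_comp_eval (μ := fun _ : Fin n => P) hf.1
  have h := meas_ge_le_variance_div_sq (μ := Measure.pi fun _ : Fin n => P)
    (X := ∑ i, fun x : Fin n → E => f (x i)) (memLp_finsetSum' _ fun i _ => hm i) ha
  rw [variance_sum_pi (X := fun _ : Fin n => f) fun _ => hf] at h
  have h0 : ∫ x : Fin n → E, (∑ i, fun x : Fin n → E => f (x i)) x ∂(Measure.pi fun _ => P)
      = 0 := by
    simp only [Finset.sum_apply]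
    rw [integral_finsetSum _ fun i _ => (hm i).integrable (by norm_num)]
    simp [he]
  rw [h0] at h
  simpa [variance_of_integral_eq_zero hf.1.aemeasurable hf0] using h

end Pi

/-- The tail of a square-integrable function beyond `√n` has measure `o(1 / n)`. -/
theorem tendsto_nat_mul_measure_sqrt_lt {E : Type*} {mE : MeasurableSpace E} {P : Measure E}
    {s : E → ℝ} (hsm : Measurable s) (hs : MemLp s 2 P) :
    Tendsto (fun n : ℕ => (n : ENNReal) * P {u | √(n : ℝ) < s u}) atTop (𝓝 0) := by
  have hT (n : ℕ) : MeasurableSet {u | √(n : ℝ) < s u} := measurableSet_lt measurable_const hsm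
  -- Where `s > √n` one has `n ≤ s²`, so the quantity is at most the integral of `s²` over that set,
  -- which vanishes by dominated convergence.
  have hlim : Tendsto (fun n : ℕ => ∫⁻ u, {u | √(n : ℝ) < s u}.indicator (fun u => ‖s u‖ₑ ^ 2) u ∂P)
      atTop (𝓝 (∫⁻ _, 0 ∂P)) := by
    refine tendsto_lintegral_of_dominated_convergence (fun u => ‖s u‖ₑ ^ 2)
      (fun n => (by fun_prop : Measurable fun u => ‖s u‖ₑ ^ 2).indicator (hT n))
      (fun n => ae_of_all _ fun u => Set.indicator_le_self _ _ u) ?_ (ae_of_all _ fun u => ?_)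
    · have := hs.eLpNorm_lt_top
      rw [eLpNorm_lt_top_iff_lintegral_rpow_enorm_lt_top (by norm_num) (by norm_num)] at this
      simpa using this.ne
    · refine tendsto_const_nhds.congr' ?_
      have : Tendsto (fun n : ℕ => √(n : ℝ)) atTop atTop :=
        Real.tendsto_sqrt_atTop.comp tendsto_natCast_atTop_atTop
      filter_upwards [this.eventually_ge_atTop (s u)] with n hn
      rw [Set.indicator_of_notMem]
      simpa using hn
  rw [lintegral_zero] at hlim
  refine tendsto_of_tendsto_of_tendsto_of_le_of_le tendsto_const_nhds hlim (fun _ => zero_le)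
    fun n => ?_
  rw [lintegral_indicator (hT n), ← setLIntegral_const]
  refine setLIntegral_mono' (hT n) fun u hu => ?_
  have h1 : (n : ℝ) ≤ s u ^ 2 := by
    rw [← Real.sq_sqrt (Nat.cast_nonneg n)]
    exact pow_le_pow_left₀ (Real.sqrt_nonneg _) (le_of_lt hu) 2
  rw [← enorm_pow, Real.enorm_eq_ofReal (sq_nonneg _), ← ENNReal.ofReal_natCast]
  exact ENNReal.ofReal_le_ofReal h1

/-! ### Regression residuals -/

section Residual

variable {E : Type*} {𝓜 mE : MeasurableSpace E} {P : Measure E} [IsProbabilityMeasure P]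

/-- On the set where the conditional mean of `q` is at most `c`, integrals of `𝓜`-measurable
functions against `q` are bounded by `c` times those against `P`. -/
theorem setLIntegral_mul_le_of_condExp_le (h𝓜 : 𝓜 ≤ mE) {q : E → ℝ} (hq : Integrable q P)
    (hqm : Measurable q) (hq0 : ∀ u, 0 ≤ q u) {c : ℝ} {f : E → ENNReal} (hf : Measurable[𝓜] f) :
    ∫⁻ u in {u | condExp 𝓜 P q u ≤ c}, f u * ENNReal.ofReal (q u) ∂P
      ≤ ENNReal.ofReal c * ∫⁻ u, f u ∂P := by
  set T : Set E := {u | condExp 𝓜 P q u ≤ c}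
  have hT : MeasurableSet[𝓜] T :=
    (stronglyMeasurable_condExp (m := 𝓜) (μ := P) (f := q)).measurable measurableSet_Iic
  -- As measures on `𝓜`, `q P` restricted to `T` is dominated by `c P`: on `𝓜`-sets `q` may be
  -- replaced by its conditional mean. Integrating `f` against both gives the claim.
  have hle : ((P.restrict T).withDensity fun u => ENNReal.ofReal (q u)).trim h𝓜
      ≤ (ENNReal.ofReal c • P).trim h𝓜 := by
    refine @Measure.le_iff _ 𝓜 _ _ |>.2 fun s hs => ?_
    rw [trim_measurableSet_eq h𝓜 hs, trim_measurableSet_eq h𝓜 hs, withDensity_apply _ (h𝓜 _ hs),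
      Measure.restrict_restrict (h𝓜 _ hs),
      ← ofReal_integral_eq_lintegral_ofReal hq.integrableOn (ae_of_all _ hq0),
      ← setIntegral_condExp h𝓜 hq (hs.inter hT), Measure.smul_apply, smul_eq_mul,
      ← ofReal_measureReal]
    by_cases hc : 0 ≤ c
    · rw [← ENNReal.ofReal_mul hc]
      refine ENNReal.ofReal_le_ofReal ?_
      calc ∫ u in s ∩ T, condExp 𝓜 P q u ∂P ≤ ∫ u in s ∩ T, c ∂P := by
            refine setIntegral_mono_on integrable_condExp.integrableOn (integrable_const _)
              (h𝓜 _ (hs.inter hT)) fun u hu => hu.2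
        _ = c * P.real (s ∩ T) := by simp [mul_comm]
        _ ≤ c * P.real s := 
            mul_le_mul_of_nonneg_left (measureReal_mono Set.inter_subset_left) hc
    · rw [ENNReal.ofReal_eq_zero.2]
      · exact zero_le
      · exact setIntegral_nonpos (h𝓜 _ (hs.inter hT)) fun u hu => hu.2.trans (not_le.1 hc).le
  calc ∫⁻ u in T, f u * ENNReal.ofReal (q u) ∂P
      = ∫⁻ u, f u ∂((P.restrict T).withDensity fun u => ENNReal.ofReal (q u)) := by
        rw [lintegral_withDensity_eq_lintegral_mul _ (by fun_prop) (hf.mono h𝓜 le_rfl)]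
        simp [mul_comm]
    _ = ∫⁻ u, f u ∂(((P.restrict T).withDensity fun u => ENNReal.ofReal (q u)).trim h𝓜) :=
        (lintegral_trim h𝓜 hf).symm
    _ ≤ ∫⁻ u, f u ∂((ENNReal.ofReal c • P).trim h𝓜) := lintegral_mono' hle le_rfl
    _ = ENNReal.ofReal c * ∫⁻ u, f u ∂P := by
        rw [lintegral_trim h𝓜 hf, lintegral_smul_measure, smul_eq_mul]

end Residual
theorem memLp_mul_of_four {E : Type*} {mE : MeasurableSpace E} {P : Measure E} {f g : E → ℝ}
    (hf : MemLp f 4 P) (hg : MemLp g 4 P) : MemLp (fun u => f u * g u) 2 P := by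
  have : ENNReal.HolderTriple 4 4 2 := ⟨by
    rw [← ENNReal.toReal_eq_toReal_iff' (by norm_num) (by norm_num),
      ENNReal.toReal_add (by norm_num) (by norm_num)]
    norm_num⟩
  exact hg.mul hf

section Residual

variable {E : Type*} {𝓜 mE : MeasurableSpace E} {P : Measure E}

theorem memLp_residual {Y : E → ℝ} (hY : MemLp Y 4 P) :
    MemLp (fun u => Y u - condExp 𝓜 P Y u) 4 P :=
  hY.sub (hY.condExp (by norm_num))

/-- The conditional variance of the residual. -/
noncomputable def residVar (𝓜 : MeasurableSpace E) {mE : MeasurableSpace E} (P : Measure E)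
    (Y : E → ℝ) : E → ℝ :=
  condExp 𝓜 P fun u => (Y u - condExp 𝓜 P Y u) ^ 2

theorem measurable_residVar {Y : E → ℝ} : Measurable[𝓜] (residVar 𝓜 P Y) :=
  stronglyMeasurable_condExp.measurable

theorem memLp_residual_sq {Y : E → ℝ} (hY : MemLp Y 4 P) :
    MemLp (fun u => (Y u - condExp 𝓜 P Y u) ^ 2) 2 P := by
  simpa only [sq] using memLp_mul_of_four (memLp_residual hY) (memLp_residual hY)

theorem memLp_residVar {Y : E → ℝ} (hY : MemLp Y 4 P) : MemLp (residVar 𝓜 P Y) 2 P :=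
  (memLp_residual_sq hY).condExp (by norm_num)

variable [IsProbabilityMeasure P]

theorem condExp_sub_condExp_self (h𝓜 : 𝓜 ≤ mE) {Y : E → ℝ} (hY : Integrable Y P) :
    condExp 𝓜 P (fun u => Y u - condExp 𝓜 P Y u) =ᵐ[P] 0 := by
  have h1 := condExp_sub hY (integrable_condExp (m := 𝓜) (f := Y) (μ := P)) 𝓜
  rw [condExp_of_stronglyMeasurable h𝓜 stronglyMeasurable_condExp integrable_condExp] at h1
  simpa [Pi.sub_def] using h1

/-- Residuals of a conditional expectation are orthogonal to `𝓜`-measurable functions. -/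
theorem condExp_mul_residual (h𝓜 : 𝓜 ≤ mE) {Y d : E → ℝ} (hY : Integrable Y P)
    (hd : StronglyMeasurable[𝓜] d)
    (hi : Integrable (fun u => d u * (Y u - condExp 𝓜 P Y u)) P) :
    condExp 𝓜 P (fun u => d u * (Y u - condExp 𝓜 P Y u)) =ᵐ[P] 0 := by
  have h1 := condExp_mul_of_stronglyMeasurable_left (μ := P)
    (g := fun u => Y u - condExp 𝓜 P Y u) hd hi (hY.sub integrable_condExp)
  filter_upwards [h1, condExp_sub_condExp_self h𝓜 hY] with u h1 h2
  have : (d * fun u => Y u - condExp 𝓜 P Y u) = fun u => d u * (Y u - condExp 𝓜 P Y u) := rfl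
  rw [← this, h1, Pi.mul_apply, h2]
  simp

theorem integral_mul_residual (h𝓜 : 𝓜 ≤ mE) {Y d : E → ℝ} (hY : Integrable Y P)
    (hd : StronglyMeasurable[𝓜] d)
    (hi : Integrable (fun u => d u * (Y u - condExp 𝓜 P Y u)) P) :
    ∫ u, d u * (Y u - condExp 𝓜 P Y u) ∂P = 0 := by
  rw [← integral_condExp h𝓜, integral_congr_ae (condExp_mul_residual h𝓜 hY hd hi)]
  simp

/-- The truncated cross term is square integrable, with a second moment that is controlled by the
`L²` norm of `d` alone. -/
theorem memLp_indicator_mul_residual (h𝓜 : 𝓜 ≤ mE) {Y d : E → ℝ} (hYm : Measurable Y)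
    (hY : MemLp Y 4 P) (hd : Measurable[𝓜] d) (hd2 : MemLp d 2 P) {c : ℝ} (hc : 0 ≤ c) :
    MemLp (fun u => {u | residVar 𝓜 P Y u ≤ c}.indicator d u * (Y u - condExp 𝓜 P Y u)) 2 P ∧
    ∫ u, ({u | residVar 𝓜 P Y u ≤ c}.indicator d u * (Y u - condExp 𝓜 P Y u)) ^ 2 ∂P
      ≤ c * ∫ u, d u ^ 2 ∂P := by
  set T : Set E := {u | residVar 𝓜 P Y u ≤ c} with hTdef
  have hT : MeasurableSet[𝓜] T := measurable_residVar measurableSet_Iic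
  have hcm : Measurable (condExp 𝓜 P Y) := stronglyMeasurable_condExp.measurable.mono h𝓜 le_rfl
  have hgm : Measurable fun u => T.indicator d u * (Y u - condExp 𝓜 P Y u) :=
    ((hd.mono h𝓜 le_rfl).indicator (h𝓜 _ hT)).mul (hYm.sub hcm)
  have hq : Integrable (fun u => (Y u - condExp 𝓜 P Y u) ^ 2) P :=
    (memLp_residual_sq hY).integrable (by norm_num)
  -- Square integrability of the product is not known in advance, so the bound is proved for the
  -- lower integral and integrability is read off from it.
  have hb := setLIntegral_mul_le_of_condExp_le (P := P) h𝓜 hq (by fun_prop) (fun u => sq_nonneg _)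
    (c := c) (f := fun u => ENNReal.ofReal (d u ^ 2)) ((hd.pow_const 2).ennreal_ofReal)
  have hleft : ∫⁻ u in {u | residVar 𝓜 P Y u ≤ c},
        ENNReal.ofReal (d u ^ 2) * ENNReal.ofReal ((Y u - condExp 𝓜 P Y u) ^ 2) ∂P
      = ∫⁻ u, ENNReal.ofReal ((T.indicator d u * (Y u - condExp 𝓜 P Y u)) ^ 2) ∂P := by
    rw [← lintegral_indicator (h𝓜 _ hT)]
    refine lintegral_congr fun u => ?_
    by_cases hu : u ∈ T
    · simp only [Set.indicator_of_mem hu, mul_pow, ENNReal.ofReal_mul (sq_nonneg (d u))]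
    · simp [Set.indicator_of_notMem hu]
  change ∫⁻ u in {u | residVar 𝓜 P Y u ≤ c}, _ ∂P ≤ _ at hb
  rw [hleft, ← ofReal_integral_eq_lintegral_ofReal hd2.integrable_sq
    (ae_of_all _ fun u => sq_nonneg _), ← ENNReal.ofReal_mul hc] at hb
  have hint : Integrable (fun u => (T.indicator d u * (Y u - condExp 𝓜 P Y u)) ^ 2) P := by
    refine ⟨(hgm.pow_const 2).aestronglyMeasurable, ?_⟩
    rw [hasFiniteIntegral_iff_ofReal (ae_of_all _ fun u => sq_nonneg _)]
    exact hb.trans_lt ENNReal.ofReal_lt_top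
  refine ⟨(memLp_two_iff_integrable_sq hgm.aestronglyMeasurable).2 hint, ?_⟩
  rw [← ofReal_integral_eq_lintegral_ofReal hint (ae_of_all _ fun u => sq_nonneg _)] at hb
  exact (ENNReal.ofReal_le_ofReal_iff
    (mul_nonneg hc (integral_nonneg fun u => sq_nonneg _))).1 hb

/-- The excess empirical risk of an approximate regression function `f`, scaled by `√n`, is small
when `f` is close to the regression function at the rate `n ^ (-1/4)` in `L²`. -/
theorem pi_excess_risk_le (h𝓜 : 𝓜 ≤ mE) {Y f : E → ℝ} (hYm : Measurable Y)
    (hY : MemLp Y 4 P) (hf : Measurable[𝓜] f)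
    (hd : MemLp (fun u => f u - condExp 𝓜 P Y u) 2 P) {n : ℕ} (hn : 0 < n) {K e : ℝ} (he : 0 < e)
    (hK : ∫ u, (f u - condExp 𝓜 P Y u) ^ 2 ∂P ≤ K / √(n : ℝ)) :
    Measure.pi (fun _ : Fin n => P) {x | e ≤ |(√(n : ℝ))⁻¹ * ∑ i,
        ((Y (x i) - f (x i)) ^ 2 - (Y (x i) - condExp 𝓜 P Y (x i)) ^ 2)|}
      ≤ ENNReal.ofReal (2 * K / e + 16 * K / e ^ 2)
        + n * P {u | √(n : ℝ) < residVar 𝓜 P Y u} := by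
  set A := condExp 𝓜 P Y with hA
  set s := √(n : ℝ) with hs
  have hs0 : 0 < s := Real.sqrt_pos.2 (by exact_mod_cast hn)
  have hss : s * s = n := Real.mul_self_sqrt (Nat.cast_nonneg n)
  have hAm : Measurable[𝓜] A := stronglyMeasurable_condExp.measurable
  set T : Set E := {u | residVar 𝓜 P Y u ≤ s} with hTdef
  have hT : MeasurableSet[𝓜] T := measurable_residVar measurableSet_Iic
  have hdm : Measurable[𝓜] fun u => A u - f u := hAm.sub hf
  have hd' : MemLp (fun u => A u - f u) 2 P := by
    simpa [Pi.neg_def] using hd.neg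
  have hK' : ∫ u, (A u - f u) ^ 2 ∂P ≤ K / s := by
    refine le_of_eq_of_le (integral_congr_ae (ae_of_all _ fun u => ?_)) hK
    show (A u - f u) ^ 2 = (f u - A u) ^ 2
    ring
  have hK0 : 0 ≤ K := by
    have := (integral_nonneg fun u => sq_nonneg (A u - f u)).trans hK'
    rwa [le_div_iff₀ hs0, zero_mul] at this
  obtain ⟨hg2, hgle⟩ := memLp_indicator_mul_residual h𝓜 hYm hY hdm hd' hs0.le
  set g : E → ℝ := fun u => T.indicator (fun u => A u - f u) u * (Y u - A u) with hg
  -- The truncation event lies in `𝓜`, so the truncated factor is still orthogonal to the residual.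
  have hg0 : ∫ u, g u ∂P = 0 :=
    integral_mul_residual h𝓜 (hY.integrable (by norm_num)) (hdm.indicator hT).stronglyMeasurable
      (hg2.integrable (by norm_num))
  -- If no sample point is truncated, the sum is the quadratic part plus twice the cross part; half
  -- of the threshold `s * e` goes to each, whence `s * e / 2` and `s * e / 4`.
  have hsub : {x : Fin n → E | e ≤ |s⁻¹ * ∑ i, ((Y (x i) - f (x i)) ^ 2 - (Y (x i) - A (x i)) ^ 2)|}
      ⊆ ({x | s * e / 2 ≤ ∑ i, (A (x i) - f (x i)) ^ 2} ∪ {x | s * e / 4 ≤ |∑ i, g (x i)|})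
        ∪ {x | ∃ i, x i ∈ {u | s < residVar 𝓜 P Y u}} := by
    intro x hx
    by_contra hcon
    simp only [Set.mem_union, Set.mem_ofPred_eq, not_or, not_le, not_exists, not_lt] at hcon hx
    obtain ⟨⟨h1, h2⟩, h3⟩ := hcon
    have hsum : ∑ i, ((Y (x i) - f (x i)) ^ 2 - (Y (x i) - A (x i)) ^ 2)
        = ∑ i, (A (x i) - f (x i)) ^ 2 + 2 * ∑ i, g (x i) := by
      rw [Finset.mul_sum, ← Finset.sum_add_distrib]
      refine Finset.sum_congr rfl fun i _ => ?_
      have : x i ∈ T := h3 i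
      simp only [hg, Set.indicator_of_mem this]
      ring
    have h0 : 0 ≤ ∑ i, (A (x i) - f (x i)) ^ 2 := Finset.sum_nonneg fun i _ => sq_nonneg _
    rw [hsum, abs_mul, abs_of_pos (inv_pos.2 hs0), inv_mul_eq_div, le_div_iff₀ hs0] at hx
    have := abs_add_le (∑ i, (A (x i) - f (x i)) ^ 2) (2 * ∑ i, g (x i))
    rw [abs_of_nonneg h0, abs_mul, abs_two] at this
    linarith
  refine (measure_mono hsub).trans <| (measure_union_le _ _).trans <|
    add_le_add ((measure_union_le _ _).trans ?_)
      (pi_exists_mem_le _ (h𝓜 _ (measurable_residVar measurableSet_Ioi)))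
  rw [ENNReal.ofReal_add (by positivity) (by positivity)]
  refine add_le_add ((pi_le_sum_le hd'.integrable_sq (fun u => sq_nonneg _) (by positivity)).trans
    (ENNReal.ofReal_le_ofReal ?_)) ((pi_le_abs_sum_le hg2 hg0 (by positivity)).trans
    (ENNReal.ofReal_le_ofReal ?_))
  · calc (n : ℝ) * (∫ u, (A u - f u) ^ 2 ∂P) / (s * e / 2) ≤ n * (K / s) / (s * e / 2) := by
          gcongr
      _ = 2 * K / e := by rw [← hss]; field_simp
  · calc (n : ℝ) * (∫ u, g u ^ 2 ∂P) / (s * e / 4) ^ 2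
          ≤ n * (s * (K / s)) / (s * e / 4) ^ 2 := by
          gcongr
          exact hgle.trans (by gcongr)
      _ = 16 * K / e ^ 2 := by rw [← hss]; field_simp; norm_num

end Residual
/-- Conditioning on an independent first component. -/
theorem measure_prodMk_mem_le {Ω F₀ F₁ : Type*} [MeasurableSpace Ω] [MeasurableSpace F₀]
    [MeasurableSpace F₁] {Pr : Measure Ω} [IsProbabilityMeasure Pr] {D₀ : Ω → F₀} {D₁ : Ω → F₁}
    (hD₀ : Measurable D₀) (hD₁ : Measurable D₁) (hind : IndepFun D₀ D₁ Pr)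
    {S : Set (F₀ × F₁)} (hS : MeasurableSet S) {B : Set F₀} (hB : MeasurableSet B) {b : ENNReal}
    (hb : ∀ x ∉ B, Pr.map D₁ {y | (x, y) ∈ S} ≤ b) :
    Pr {ω | (D₀ ω, D₁ ω) ∈ S} ≤ Pr {ω | D₀ ω ∈ B} + b := by
  have := Measure.isProbabilityMeasure_map (μ := Pr) hD₁.aemeasurable
  have := Measure.isProbabilityMeasure_map (μ := Pr) hD₀.aemeasurable
  calc Pr {ω | (D₀ ω, D₁ ω) ∈ S} = Pr.map (fun ω => (D₀ ω, D₁ ω)) S :=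
        (Measure.map_apply (hD₀.prodMk hD₁) hS).symm
    _ = ∫⁻ x, Pr.map D₁ (Prod.mk x ⁻¹' S) ∂(Pr.map D₀) := by
        rw [(indepFun_iff_map_prod_eq_prod_map_map hD₀.aemeasurable hD₁.aemeasurable).1 hind,
          Measure.prod_apply hS]
    _ ≤ ∫⁻ x, (B.indicator 1 x + b) ∂(Pr.map D₀) := by
        refine lintegral_mono fun x => ?_
        by_cases hx : x ∈ B
        · exact prob_le_one.trans (by simp [hx])
        · exact (hb x hx).trans (by simp [hx])
    _ = Pr {ω | D₀ ω ∈ B} + b := by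
        rw [lintegral_add_right _ measurable_const, lintegral_indicator_one hB,
          Measure.map_apply hD₀ hB]
        simp
        rfl

/-! ### Excess risk of a regression fitted on an independent sample -/

section ExcessRisk

variable {E : Type*} {𝓜 mE : MeasurableSpace E} {P : Measure E}

/-- Makes the set of training samples with a large `L²` error measurable, as conditioning on the
training sample requires. -/
theorem measurable_eLpNorm_two_of_prod [SFinite P] {F : Type*} [MeasurableSpace F]
    {f : F → E → ℝ} (hf : Measurable fun p : F × E => f p.1 p.2) :
    Measurable fun x => eLpNorm (f x) 2 P := by
  simp_rw [eLpNorm_eq_lintegral_rpow_enorm_toReal (p := 2) (by norm_num) (by norm_num)]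
  refine Measurable.pow_const ?_ _
  exact Measurable.lintegral_prod_right' (f := fun p : F × E => ‖f p.1 p.2‖ₑ ^ (2 : ENNReal).toReal)
    (by fun_prop)

theorem integral_sq_le_of_eLpNorm_le {d : E → ℝ} (hd : Measurable d) {c : ℝ} (hc : 0 ≤ c)
    (h : eLpNorm d 2 P ≤ ENNReal.ofReal c) : MemLp d 2 P ∧ ∫ u, d u ^ 2 ∂P ≤ c ^ 2 := by
  have hm : MemLp d 2 P := ⟨hd.aestronglyMeasurable, h.trans_lt ENNReal.ofReal_lt_top⟩
  refine ⟨hm, ?_⟩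
  have h2 := eLpNorm_nnreal_pow_eq_lintegral (f := d) (μ := P) (p := 2) (by norm_num)
  have h3 : ENNReal.ofReal (∫ u, d u ^ 2 ∂P) ≤ ENNReal.ofReal (c ^ 2) := by
    rw [ofReal_integral_eq_lintegral_ofReal hm.integrable_sq (ae_of_all _ fun u => sq_nonneg _),
      ENNReal.ofReal_pow hc]
    calc ∫⁻ u, ENNReal.ofReal (d u ^ 2) ∂P = eLpNorm d 2 P ^ 2 := by
          simp only [ENNReal.coe_ofNat, NNReal.coe_ofNat, ENNReal.rpow_ofNat] at h2
          rw [h2]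
          refine lintegral_congr fun u => ?_
          rw [← Real.enorm_eq_ofReal (sq_nonneg _), enorm_pow]
      _ ≤ ENNReal.ofReal c ^ 2 := by gcongr
  exact (ENNReal.ofReal_le_ofReal_iff (sq_nonneg c)).1 h3

/-- The excess empirical risk of a regression estimator that is fitted on an independent training
sample and converges at the rate `o_P(n ^ (-1/4))` is `o_P(n ^ (-1/2))` on the evaluation sample. -/
theorem tendstoInMeasure_excess_risk {Ω : Type*} [MeasurableSpace Ω] {Pr : Measure Ω}
    [IsProbabilityMeasure Pr] [IsProbabilityMeasure P] {F : ℕ → Type*} [∀ n, MeasurableSpace (F n)]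
    {D₀ : (n : ℕ) → Ω → F n} {D₁ : (n : ℕ) → Ω → Fin n → E} (hD₀ : ∀ n, Measurable (D₀ n))
    (hD₁ : ∀ n, Measurable (D₁ n)) (hind : ∀ n, IndepFun (D₀ n) (D₁ n) Pr)
    (hlaw : ∀ n, Pr.map (D₁ n) = Measure.pi fun _ => P)
    {Y : E → ℝ} (hYm : Measurable Y) (hY : MemLp Y 4 P) (h𝓜 : 𝓜 ≤ mE) (f : (n : ℕ) → F n → E → ℝ)
    (hfm : ∀ n, Measurable fun p : F n × E => f n p.1 p.2)
    (hf : ∀ n D, Measurable[𝓜] (f n D))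
    (hrate : IsLittleOP Pr (fun n ω => eLpNorm (fun u => f n (D₀ n ω) u
      - condExp 𝓜 P Y u) 2 P) (fun n => (n : ℝ) ^ (-(1 / 4) : ℝ))) :
    TendstoInMeasure Pr (fun (n : ℕ) ω => (√(n : ℝ))⁻¹ * ∑ i,
        ((Y (D₁ n ω i) - f n (D₀ n ω) (D₁ n ω i)) ^ 2
          - (Y (D₁ n ω i) - condExp 𝓜 P Y (D₁ n ω i)) ^ 2))
      atTop 0 := by
  rw [tendstoInMeasure_iff_norm]
  intro e he
  have hAm : Measurable (condExp 𝓜 P Y) := stronglyMeasurable_condExp.measurable.mono h𝓜 le_rfl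
  rw [ENNReal.tendsto_nhds_zero]
  intro η hη
  have hη3 : 0 < η / 3 := ENNReal.div_pos hη.ne' (by norm_num)
  -- The rate holds with every constant `δ`, so `δ` may be taken small enough for the Markov and
  -- Chebyshev bounds with `K = δ²`.
  obtain ⟨δ, hδ, hδ0⟩ : ∃ δ : ℝ, ENNReal.ofReal (2 * δ ^ 2 / e + 16 * δ ^ 2 / e ^ 2) ≤ η / 3
      ∧ 0 < δ := by
    have hc : Tendsto (fun δ : ℝ => ENNReal.ofReal (2 * δ ^ 2 / e + 16 * δ ^ 2 / e ^ 2))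
        (𝓝[>] 0) (𝓝 0) := by
      have : Continuous fun δ : ℝ => ENNReal.ofReal (2 * δ ^ 2 / e + 16 * δ ^ 2 / e ^ 2) := 
        ENNReal.continuous_ofReal.comp (by fun_prop)
      simpa using (this.tendsto 0).mono_left nhdsWithin_le_nhds
    exact (((ENNReal.tendsto_nhds_zero.1 hc) _ hη3).and self_mem_nhdsWithin).exists
  have htail := tendsto_nat_mul_measure_sqrt_lt
    (measurable_residVar.mono h𝓜 le_rfl) (memLp_residVar (𝓜 := 𝓜) hY)
  filter_upwards [ENNReal.tendsto_nhds_zero.1 htail _ hη3,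
    ENNReal.tendsto_nhds_zero.1 (hrate δ hδ0) _ hη3, eventually_gt_atTop 0] with n h1 h2 hn
  have hn0 : (0 : ℝ) < n := by exact_mod_cast hn
  set S : Set (F n × (Fin n → E)) := {p | e ≤ |(√(n : ℝ))⁻¹ * ∑ i,
    ((Y (p.2 i) - f n p.1 (p.2 i)) ^ 2 - (Y (p.2 i) - condExp 𝓜 P Y (p.2 i)) ^ 2)|} with hS
  have hSm : MeasurableSet S := by
    refine measurableSet_le measurable_const (Measurable.abs (Measurable.const_mul
      (Finset.measurable_fun_sum _ fun i _ => ?_) _))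
    have h1 : Measurable fun p : F n × (Fin n → E) => p.2 i := by fun_prop
    have h2 : Measurable fun p : F n × (Fin n → E) => f n p.1 (p.2 i) :=
      (hfm n).comp (measurable_fst.prodMk h1)
    exact (((hYm.comp h1).sub h2).pow_const 2).sub (((hYm.comp h1).sub (hAm.comp h1)).pow_const 2)
  set B : Set (F n) := {D | ENNReal.ofReal (δ * (n : ℝ) ^ (-(1 / 4) : ℝ))
    < eLpNorm (fun u => f n D u - condExp 𝓜 P Y u) 2 P} with hB
  have hBm : MeasurableSet B := by
    refine measurableSet_lt measurable_const (measurable_eLpNorm_two_of_prod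
      (f := fun D u => f n D u - condExp 𝓜 P Y u) ?_)
    exact (hfm n).sub (hAm.comp measurable_snd)
  have key := measure_prodMk_mem_le (b := η / 3 + η / 3) (hD₀ n) (hD₁ n) (hind n)
    hSm hBm (fun D hD => by
      rw [hlaw]
      have hfD : Measurable (f n D) := (hf n D).mono h𝓜 le_rfl
      obtain ⟨hd2, hdle⟩ := integral_sq_le_of_eLpNorm_le
        (d := fun u => f n D u - condExp 𝓜 P Y u) (by fun_prop) (by positivity) (not_lt.1 hD)
      refine (pi_excess_risk_le h𝓜 hYm hY (hf n D) hd2 hn he (K := δ ^ 2)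
        (hdle.trans_eq ?_)).trans (add_le_add hδ h1)
      -- This is `(δ n^(-1/4))² = δ² / √n`.
      rw [mul_pow, ← Real.rpow_natCast ((n : ℝ) ^ _), ← Real.rpow_mul hn0.le,
        Real.sqrt_eq_rpow, div_eq_mul_inv (δ ^ 2), ← Real.rpow_neg hn0.le]
      norm_num)
  calc _ = Pr {ω | (D₀ n ω, D₁ n ω) ∈ S} := by
        simp [hS]
    _ ≤ _ := key
    _ ≤ η / 3 + (η / 3 + η / 3) := by gcongr; exact h2
    _ = η := by rw [← add_assoc, ENNReal.add_thirds]

end ExcessRisk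

/-! ### Joint law of the training and evaluation samples -/

section Samples

variable {g h : ℕ} {Ω : Type*} [MeasurableSpace Ω] {Pr : Measure Ω}
  {P : Measure (Obs g h)} {U : ℕ → Ω → Obs g h}

theorem measurable_trainSample (hU : ∀ i, Measurable (U i)) (m : ℕ) :
    Measurable (trainSample U m) :=
  measurable_pi_lambda _ fun i => hU i

theorem measurable_evalSample (hU : ∀ i, Measurable (U i)) (m n : ℕ) :
    Measurable (evalSample U m n) :=
  measurable_pi_lambda _ fun i => hU (m + i)

theorem indepFun_trainSample_evalSample (hU : ∀ i, Measurable (U i)) (hindep : iIndepFun U Pr)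
    (m n : ℕ) : IndepFun (trainSample U m) (evalSample U m n) Pr := by
  have hfs := hindep.indepFun_finset (Finset.range m) (Finset.Ico m (m + n))
    (by
      rw [Finset.disjoint_left]
      intro a ha hb
      rw [Finset.mem_range] at ha
      rw [Finset.mem_Ico] at hb
      omega) hU
  exact hfs.comp
    (φ := fun (x : Finset.range m → Obs g h) (i : Fin m) => x ⟨i, Finset.mem_range.2 i.2⟩)
    (ψ := fun (x : Finset.Ico m (m + n) → Obs g h) (i : Fin n) =>
      x ⟨m + i, Finset.mem_Ico.2 ⟨by omega, by omega⟩⟩)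
    (measurable_pi_lambda _ fun i => measurable_pi_apply _)
    (measurable_pi_lambda _ fun i => measurable_pi_apply _)

theorem map_evalSample [IsProbabilityMeasure Pr] (hU : ∀ i, Measurable (U i))
    (hlaw : ∀ i, Pr.map (U i) = P) (hindep : iIndepFun U Pr) (m n : ℕ) :
    Pr.map (evalSample U m n) = Measure.pi fun _ => P := by
  have hi : iIndepFun (fun i : Fin n => U (m + i)) Pr :=
    hindep.precomp (g := fun i : Fin n => m + (i : ℕ)) fun i j hij => by
      simpa [Fin.ext_iff] using hij
  have := (iIndepFun_iff_map_fun_eq_pi_map fun i : Fin n => (hU (m + i)).aemeasurable).1 hi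
  simp only [hlaw] at this
  exact this

end Samples

/-! ### Consistency of the screening step -/

theorem sum_sub_sampleMean_mul {m : ℕ} (hm : 0 < m) (a b : Fin m → ℝ) :
    ∑ i, (a i - sampleMean a) * (b i - sampleMean b)
      = m * (sampleMean (fun i => a i * b i) - sampleMean a * sampleMean b) := by
  have hm' : (m : ℝ) ≠ 0 := by exact_mod_cast hm.ne'
  have ha : ∑ i, a i = m * sampleMean a := by unfold sampleMean; field_simp
  have hb : ∑ i, b i = m * sampleMean b := by unfold sampleMean; field_simp
  have hab : ∑ i, a i * b i = m * sampleMean (fun i => a i * b i) := by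
    unfold sampleMean; field_simp
  simp only [sub_mul, mul_sub, Finset.sum_sub_distrib, ← Finset.sum_mul, ← Finset.mul_sum, hab, ha,
    hb, Finset.sum_const, Finset.card_univ, Fintype.card_fin, nsmul_eq_mul]
  ring

/-- The factors `m` cancel, leaving a function of five sample means, to each of which the strong law
applies. -/
theorem samplePearson_eq {m : ℕ} (hm : 0 < m) (a b : Fin m → ℝ) :
    samplePearson a b = (sampleMean (fun i => a i * b i) - sampleMean a * sampleMean b) /
      (√(sampleMean (fun i => a i * a i) - sampleMean a * sampleMean a) *
        √(sampleMean (fun i => b i * b i) - sampleMean b * sampleMean b)) := by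
  have hm' : (0 : ℝ) < m := by exact_mod_cast hm
  unfold samplePearson
  simp only [sq, sum_sub_sampleMean_mul hm, Real.sqrt_mul hm'.le]
  rw [mul_mul_mul_comm, Real.mul_self_sqrt hm'.le, mul_div_mul_left _ _ hm'.ne']

/-- Serves the case of zero population variance, where the quotient is not continuous but the sample
is almost surely constant. -/
theorem samplePearson_eq_zero_of_const_left {m : ℕ} {a : Fin m → ℝ} {c : ℝ} (ha : ∀ i, a i = c)
    (b : Fin m → ℝ) : samplePearson a b = 0 := by
  have h (i : Fin m) : a i - sampleMean a = 0 := by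
    have : (m : ℝ) ≠ 0 := by exact_mod_cast i.pos.ne'
    simp [sampleMean, ha, this]
  simp [samplePearson, h]

theorem samplePearson_eq_zero_of_const_right {m : ℕ} (a : Fin m → ℝ) {b : Fin m → ℝ} {c : ℝ}
    (hb : ∀ i, b i = c) : samplePearson a b = 0 := by
  have h (i : Fin m) : b i - sampleMean b = 0 := by
    have : (m : ℝ) ≠ 0 := by exact_mod_cast i.pos.ne'
    simp [sampleMean, hb, this]
  simp [samplePearson, h]

theorem measurable_samplePearson {m : ℕ} {F : Type*} [MeasurableSpace F] {a b : F → Fin m → ℝ}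
    (ha : Measurable a) (hb : Measurable b) : Measurable fun x => samplePearson (a x) (b x) := by
  unfold samplePearson sampleMean
  fun_prop

section Screening

variable {g h : ℕ} {Ω : Type*} [MeasurableSpace Ω] {Pr : Measure Ω}
  {P : Measure (Obs g h)} {U : ℕ → Ω → Obs g h}

theorem Obs.measurable_X (i : Fin g) : Measurable fun u : Obs g h => Obs.X u i := by
  unfold Obs.X; fun_prop

theorem Obs.measurable_Z (j : Fin h) : Measurable fun u : Obs g h => Obs.Z u j := by
  unfold Obs.Z; fun_prop

theorem Obs.measurable_Y : Measurable fun u : Obs g h => Obs.Y u := by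
  unfold Obs.Y; fun_prop

theorem measurable_rhoHat {m : ℕ} (j : Fin h) :
    Measurable fun D : Fin m → Obs g h => rhoHat D j := by
  unfold rhoHat
  refine Finset.measurable_fun_sum _ fun i _ => (measurable_samplePearson ?_ ?_).abs
  · exact measurable_pi_lambda _ fun k => (Obs.measurable_X i).comp (measurable_pi_apply k)
  · exact measurable_pi_lambda _ fun k => (Obs.measurable_Z j).comp (measurable_pi_apply k)

theorem measurableSet_screenedHat_eq {m : ℕ} (t : ℝ) (S : Finset (Fin h)) :
    MeasurableSet {D : Fin m → Obs g h | screenedHat D t = S} := by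
  have : {D : Fin m → Obs g h | screenedHat D t = S}
      = ⋂ j, {D | rhoHat D j ≤ t ↔ j ∈ S} := by
    ext D
    simp [screenedHat, Finset.ext_iff]
  rw [this]
  refine MeasurableSet.iInter fun j => ?_
  exact (measurableSet_le (measurable_rhoHat j) measurable_const).iff (MeasurableSet.const _)

theorem ae_forall_sample (hU : ∀ i, Measurable (U i)) (hlaw : ∀ i, Pr.map (U i) = P)
    {p : Obs g h → Prop} (hp : ∀ᵐ u ∂P, p u) : ∀ᵐ ω ∂Pr, ∀ k, p (U k ω) := by
  refine ae_all_iff.2 fun k => ?_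
  rw [← hlaw k] at hp
  exact ae_of_ae_map (hU k).aemeasurable hp

theorem tendsto_sampleMean (hU : ∀ i, Measurable (U i)) (hlaw : ∀ i, Pr.map (U i) = P)
    (hindep : iIndepFun U Pr) {φ : Obs g h → ℝ} (hφ : Measurable φ) (hi : Integrable φ P) :
    ∀ᵐ ω ∂Pr, Tendsto (fun n : ℕ => sampleMean fun k : Fin n => φ (U k ω)) atTop
      (𝓝 (∫ u, φ u ∂P)) := by
  have hid (i : ℕ) : IdentDistrib (φ ∘ U i) (φ ∘ U 0) Pr Pr :=
    IdentDistrib.comp ⟨(hU i).aemeasurable, (hU 0).aemeasurable, by rw [hlaw, hlaw]⟩ hφ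
  have hint : Integrable (φ ∘ U 0) Pr := by
    rw [← integrable_map_measure (by rw [hlaw]; exact hi.1) (hU 0).aemeasurable, hlaw]
    exact hi
  have := strong_law_ae_real (fun i => φ ∘ U i) hint
    (fun i j hij => (hindep.indepFun hij).comp hφ hφ) hid
  filter_upwards [this] with ω hω
  have he : ∫ ω, (φ ∘ U 0) ω ∂Pr = ∫ u, φ u ∂P := by
    rw [← hlaw 0, integral_map (hU 0).aemeasurable hφ.aestronglyMeasurable]
    rfl
  rw [he] at hω
  simpa [sampleMean, Finset.sum_range] using hω

variable [IsProbabilityMeasure P]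

/-- With positive variances this is the strong law for five means and continuity of the quotient;
otherwise both correlations are `0` by convention. -/
theorem tendsto_samplePearson (hU : ∀ i, Measurable (U i)) (hlaw : ∀ i, Pr.map (U i) = P)
    (hindep : iIndepFun U Pr) {φ χ : Obs g h → ℝ} (hφm : Measurable φ) (hχm : Measurable χ)
    (hφ : MemLp φ 2 P) (hχ : MemLp χ 2 P) :
    ∀ᵐ ω ∂Pr, Tendsto (fun n : ℕ => samplePearson (fun k : Fin n => φ (U k ω))
      fun k : Fin n => χ (U k ω)) atTop (𝓝 (pearson φ χ P)) := by
  by_cases hvφ : variance φ P = 0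
  · have hc := ae_eq_integral_of_variance_eq_zero hφ hvφ
    filter_upwards [ae_forall_sample hU hlaw hc] with ω hω
    simp [samplePearson_eq_zero_of_const_left fun k : Fin _ => hω k, pearson, hvφ]
  by_cases hvχ : variance χ P = 0
  · have hc := ae_eq_integral_of_variance_eq_zero hχ hvχ
    filter_upwards [ae_forall_sample hU hlaw hc] with ω hω
    simp [samplePearson_eq_zero_of_const_right _ fun k : Fin _ => hω k, pearson, hvχ]
  have h1 : (1 : ENNReal) ≤ 2 := by norm_num
  filter_upwards [tendsto_sampleMean hU hlaw hindep hφm (hφ.integrable h1),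
    tendsto_sampleMean hU hlaw hindep hχm (hχ.integrable h1),
    tendsto_sampleMean hU hlaw hindep (hφm.mul hχm) (hφ.integrable_mul hχ),
    tendsto_sampleMean hU hlaw hindep (hφm.mul hφm) (hφ.integrable_mul hφ),
    tendsto_sampleMean hU hlaw hindep (hχm.mul hχm) (hχ.integrable_mul hχ)] with ω h1 h2 h3 h4 h5
  have hv (f : Obs g h → ℝ) (hf : MemLp f 2 P) :
      variance f P = ∫ u, (f * f) u ∂P - (∫ u, f u ∂P) * ∫ u, f u ∂P := by
    rw [variance_eq_sub hf, sq, sq]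
  rw [pearson, covariance_eq_sub hφ hχ]
  rw [hv φ hφ] at hvφ ⊢
  rw [hv χ hχ] at hvχ ⊢
  have hlim := (h3.sub (h1.mul h2)).div
    ((((Real.continuous_sqrt.tendsto _).comp (h4.sub (h1.mul h1)))).mul
      ((Real.continuous_sqrt.tendsto _).comp (h5.sub (h2.mul h2)))) (by
    rw [← hv φ hφ] at hvφ ⊢
    rw [← hv χ hχ] at hvχ ⊢
    exact mul_ne_zero (Real.sqrt_ne_zero'.2 ((variance_nonneg _ _).lt_of_ne' hvφ))
      (Real.sqrt_ne_zero'.2 ((variance_nonneg _ _).lt_of_ne' hvχ)))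
  refine hlim.congr' ?_
  filter_upwards [eventually_gt_atTop 0] with n hn
  rw [samplePearson_eq hn]
  rfl

theorem tendsto_rhoHat (hU : ∀ i, Measurable (U i)) (hlaw : ∀ i, Pr.map (U i) = P)
    (hindep : iIndepFun U Pr) (hX : ∀ i, MemLp (fun u => Obs.X u i) 2 P)
    (hZ : ∀ j, MemLp (fun u => Obs.Z u j) 2 P) :
    ∀ᵐ ω ∂Pr, ∀ j, Tendsto (fun n : ℕ => rhoHat (trainSample U n ω) j) atTop (𝓝 (rho P j)) := by
  refine ae_all_iff.2 fun j => ?_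
  have : ∀ᵐ ω ∂Pr, ∀ i, Tendsto (fun n : ℕ => samplePearson (fun k : Fin n => Obs.X (U k ω) i)
      fun k : Fin n => Obs.Z (U k ω) j) atTop
      (𝓝 (pearson (fun u => Obs.X u i) (fun u => Obs.Z u j) P)) :=
    ae_all_iff.2 fun i => tendsto_samplePearson (φ := fun u => Obs.X u i)
      (χ := fun u => Obs.Z u j) hU hlaw hindep (Obs.measurable_X i) (Obs.measurable_Z j)
      (hX i) (hZ j)
  filter_upwards [this] with ω hω
  exact tendsto_finsetSum _ fun i _ => (hω i).abs

/-- Away from ties, the screening step selects the right variables with probability tending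
to one. -/
theorem tendsto_measure_screenedHat_ne [IsProbabilityMeasure Pr]
    (hU : ∀ i, Measurable (U i)) (hlaw : ∀ i, Pr.map (U i) = P)
    (hindep : iIndepFun U Pr) (hX : ∀ i, MemLp (fun u => Obs.X u i) 2 P)
    (hZ : ∀ j, MemLp (fun u => Obs.Z u j) 2 P) {t : ℝ} (ht : ∀ j, rho P j ≠ t)
    {m : ℕ → ℕ} (hm : Tendsto m atTop atTop) :
    Tendsto (fun n => Pr {ω | screenedHat (trainSample U (m n) ω) t ≠ screened P t})
      atTop (𝓝 0) := by
  have hev : ∀ᵐ ω ∂Pr, ∀ᶠ n in atTop,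
      screenedHat (trainSample U (m n) ω) t = screened P t := by
    filter_upwards [tendsto_rhoHat hU hlaw hindep hX hZ] with ω hω
    -- Without ties the limit lies strictly on one side of `t`, so the comparison is eventually
    -- settled, jointly for the finitely many `j`.
    have : ∀ j, ∀ᶠ n in atTop, (rhoHat (trainSample U (m n) ω) j ≤ t ↔ rho P j ≤ t) := by
      intro j
      have hj := (hω j).comp hm
      rcases (ht j).lt_or_gt with hlt | hgt
      · filter_upwards [hj.eventually_lt_const hlt] with n hn
        exact ⟨fun _ => hlt.le, fun _ => hn.le⟩
      · filter_upwards [hj.eventually_const_lt hgt] with n hn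
        exact ⟨fun h' => absurd h' (not_le.2 hn), fun h' => absurd h' (not_le.2 hgt)⟩
    filter_upwards [eventually_all.2 this] with n hn
    ext j
    simp [screenedHat, screened, hn j]
  have hms (n : ℕ) : MeasurableSet {ω | screenedHat (trainSample U (m n) ω) t ≠ screened P t} :=
    (measurable_trainSample hU (m n) (measurableSet_screenedHat_eq t (screened P t))).compl
  have := tendsto_measure_of_ae_tendsto_indicator_of_isFiniteMeasure (μ := Pr) (A := ∅) atTop
    MeasurableSet.empty hms ?_
  · simpa using this
  · filter_upwards [hev] with ω hω
    filter_upwards [hω] with n hn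
    simp [hn]

end Screening

/-! ### The increase of the risk when covariates are left out -/

section RiskIncrease

variable {E : Type*} {𝓜 mE : MeasurableSpace E} {P : Measure E} {Y B : E → ℝ}

theorem memLp_riskIncrease (hY : MemLp Y 4 P) (hB : MemLp B 4 P) :
    MemLp (fun u => (Y u - B u) ^ 2 - (Y u - condExp 𝓜 P Y u) ^ 2) 2 P := by
  have h1 := hY.sub hB
  have h2 : MemLp (fun u => (Y u - B u) ^ 2) 2 P := by
    simpa only [sq, Pi.sub_apply] using memLp_mul_of_four h1 h1
  exact h2.sub (memLp_residual_sq hY)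

/-- When `B` is `𝓜`-measurable, the first term is `𝓜`-measurable and the second has conditional mean
zero. -/
theorem riskIncrease_eq : (fun u => (Y u - B u) ^ 2 - (Y u - condExp 𝓜 P Y u) ^ 2)
    = (fun u => (condExp 𝓜 P Y u - B u) ^ 2)
      + fun u => (2 * (condExp 𝓜 P Y u - B u)) * (Y u - condExp 𝓜 P Y u) := by
  ext u
  simp only [Pi.add_apply]
  ring

theorem memLp_regression_sub (hY : MemLp Y 4 P) (hB : MemLp B 4 P) :
    MemLp (fun u => condExp 𝓜 P Y u - B u) 4 P :=
  (hY.condExp (by norm_num)).sub hB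

variable [IsProbabilityMeasure P]

theorem integrable_regression_sub_sq (hY : MemLp Y 4 P) (hB : MemLp B 4 P) :
    Integrable (fun u => (condExp 𝓜 P Y u - B u) ^ 2) P := by
  have h := memLp_regression_sub (𝓜 := 𝓜) hY hB
  simpa only [sq] using (memLp_mul_of_four h h).integrable (by norm_num)

theorem integrable_regression_sub_mul_residual (hY : MemLp Y 4 P) (hB : MemLp B 4 P) :
    Integrable (fun u => (2 * (condExp 𝓜 P Y u - B u)) * (Y u - condExp 𝓜 P Y u)) P :=
  (memLp_mul_of_four ((memLp_regression_sub hY hB).const_mul 2)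
    (memLp_residual hY)).integrable (by norm_num)

theorem condExp_riskIncrease (h𝓜 : 𝓜 ≤ mE) (hY : MemLp Y 4 P) (hB : MemLp B 4 P)
    (hBm : StronglyMeasurable[𝓜] B) :
    condExp 𝓜 P (fun u => (Y u - B u) ^ 2 - (Y u - condExp 𝓜 P Y u) ^ 2)
      =ᵐ[P] fun u => (condExp 𝓜 P Y u - B u) ^ 2 := by
  have hdm : StronglyMeasurable[𝓜] fun u => condExp 𝓜 P Y u - B u :=
    stronglyMeasurable_condExp.sub hBm
  rw [riskIncrease_eq]
  have hi := integrable_regression_sub_sq (𝓜 := 𝓜) hY hB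
  have hi' := integrable_regression_sub_mul_residual (𝓜 := 𝓜) hY hB
  filter_upwards [condExp_add hi hi' 𝓜,
    condExp_mul_residual h𝓜 (hY.integrable (by norm_num)) (hdm.const_mul 2) hi'] with u h1 h2
  have h3 : condExp 𝓜 P (fun u => (condExp 𝓜 P Y u - B u) ^ 2)
      = fun u => (condExp 𝓜 P Y u - B u) ^ 2 := condExp_of_stronglyMeasurable h𝓜 (hdm.pow 2) hi
  rw [h1, Pi.add_apply, h2, h3]
  simp

theorem integral_riskIncrease (h𝓜 : 𝓜 ≤ mE) (hY : MemLp Y 4 P) (hB : MemLp B 4 P)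
    (hBm : StronglyMeasurable[𝓜] B) :
    ∫ u, ((Y u - B u) ^ 2 - (Y u - condExp 𝓜 P Y u) ^ 2) ∂P
      = ∫ u, (condExp 𝓜 P Y u - B u) ^ 2 ∂P := by
  rw [← integral_condExp h𝓜, integral_congr_ae (condExp_riskIncrease h𝓜 hY hB hBm)]

/-- If leaving out covariates increases the risk, the increase is degenerate only if the full
regression is exact. -/
theorem variance_riskIncrease_pos (h𝓜 : 𝓜 ≤ mE) (hY : MemLp Y 4 P) (hB : MemLp B 4 P)
    (hBm : StronglyMeasurable[𝓜] B) (hψ : ∫ u, (condExp 𝓜 P Y u - B u) ^ 2 ∂P ≠ 0)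
    (hne : ¬ Y =ᵐ[P] condExp 𝓜 P Y) :
    0 < variance (fun u => (Y u - B u) ^ 2 - (Y u - condExp 𝓜 P Y u) ^ 2) P := by
  refine (variance_nonneg _ _).lt_of_ne' fun h0 => hne ?_
  have hc := ae_eq_integral_of_variance_eq_zero (memLp_riskIncrease hY hB) h0
  rw [integral_riskIncrease h𝓜 hY hB hBm] at hc
  have hc' := condExp_congr_ae (m := 𝓜) hc
  rw [condExp_const h𝓜] at hc'
  filter_upwards [hc, hc', condExp_riskIncrease h𝓜 hY hB hBm] with u h1 h2 h3
  rw [h3] at h2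
  -- The increase and its conditional mean `(A - B)²`, with `A = E[Y | 𝓜]`, both equal the same
  -- constant, so the cross term that separates them vanishes. That constant is nonzero, which rules
  -- out `A = B`.
  have h4 : (condExp 𝓜 P Y u - B u) * (Y u - condExp 𝓜 P Y u) = 0 := by nlinarith
  rcases mul_eq_zero.1 h4 with h5 | h5
  · rw [h5] at h2
    exact absurd (by simpa using h2.symm) hψ
  · linarith

end RiskIncrease

/-! ### Central limit theorem on moving windows and measurability of the estimator -/

section Asymptotics

variable {g h : ℕ} {Ω : Type*} [MeasurableSpace Ω] {Pr : Measure Ω}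
  {P : Measure (Obs g h)} {U : ℕ → Ω → Obs g h}

/-- The central limit theorem on the evaluation samples. -/
theorem tendstoInDistribution_evalSample [IsProbabilityMeasure Pr] (hU : ∀ i, Measurable (U i))
    (hlaw : ∀ i, Pr.map (U i) = P) (hindep : iIndepFun U Pr) (m : ℕ → ℕ) {W : Obs g h → ℝ}
    (hWm : Measurable W) (hW : MemLp W 2 P) :
    TendstoInDistribution (fun (n : ℕ) (ω : Ω) => (√(n : ℝ))⁻¹ *
        (∑ i, W (evalSample U (m n) n ω i) - n * ∫ u, W u ∂P))
      atTop (id : ℝ → ℝ) (fun _ => Pr) (gaussianReal 0 (variance W P).toNNReal) := by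
  have hid (i : ℕ) : IdentDistrib (W ∘ U i) (W ∘ U 0) Pr Pr :=
    IdentDistrib.comp ⟨(hU i).aemeasurable, (hU 0).aemeasurable, by rw [hlaw, hlaw]⟩ hWm
  have hid0 : IdentDistrib (W ∘ U 0) W Pr P :=
    IdentDistrib.comp (u := W) (f := U 0) (g := id)
      ⟨(hU 0).aemeasurable, aemeasurable_id, by rw [hlaw, Measure.map_id]⟩ hWm
  have hclt := tendstoInDistribution_inv_sqrt_mul_sum_sub (P := Pr) (X := fun i => W ∘ U i)
    (P' := gaussianReal 0 (variance W P).toNNReal) (Y := id)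
    (by rw [hid0.variance_eq]; exact HasLaw.id) (hid0.memLp_iff.2 hW)
    (hindep.comp (fun _ => W) fun _ => hWm) hid
  have hΦ (n : ℕ) : Measurable fun x : Fin n → Obs g h =>
      (√(n : ℝ))⁻¹ * (∑ i, W (x i) - n * ∫ u, W u ∂P) := by fun_prop
  have hmeas (n : ℕ) : Measurable fun ω => (√(n : ℝ))⁻¹ *
      (∑ i, W (evalSample U (m n) n ω i) - n * ∫ u, W u ∂P) :=
    (hΦ n).comp (measurable_evalSample hU (m n) n)
  refine ⟨fun n => (hmeas n).aemeasurable, aemeasurable_id, ?_⟩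
  -- The window moves with `n`, but its law is the same product measure as that of the first `n`
  -- observations, and only laws matter here.
  refine hclt.tendsto.congr fun n => Subtype.ext ?_
  have h0 : (fun ω => (√(n : ℝ))⁻¹ * (∑ k ∈ Finset.range n, (W ∘ U k) ω
      - n * ∫ ω, (W ∘ U 0) ω ∂Pr)) = (fun x : Fin n → Obs g h =>
      (√(n : ℝ))⁻¹ * (∑ i, W (x i) - n * ∫ u, W u ∂P)) ∘ evalSample U 0 n := by
    ext ω
    rw [hid0.integral_eq]
    simp [evalSample, Finset.sum_range]
  change Pr.map _ = Pr.map _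
  rw [h0, ← Measure.map_map (hΦ n) (measurable_evalSample hU 0 n), map_evalSample hU hlaw hindep,
    ← map_evalSample hU hlaw hindep (m n) n, Measure.map_map (hΦ n) (measurable_evalSample hU _ n)]
  rfl

theorem Obs.measurable_V (S : Finset (Fin h)) : Measurable fun u : Obs g h => Obs.V S u :=
  measurable_pi_lambda _ fun j => Obs.measurable_Z j.1

theorem Obs.measurable_XV (S : Finset (Fin h)) :
    Measurable fun u : Obs g h => (Obs.X u, Obs.V S u) :=
  measurable_fst.prodMk (Obs.measurable_V S)

/-- The difference of the empirical risks of the two regressions on `V = (Z_j : j ∈ S)`. -/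
noncomputable def riskDiff {m n : ℕ} (M : RegMethod g h m) (S : Finset (Fin h))
    (D₀ : Fin m → Obs g h) (D₁ : Fin n → Obs g h) : ℝ :=
  (∑ i, (Obs.Y (D₁ i) - M.muV S D₀ (Obs.V S (D₁ i))) ^ 2) / n
  - (∑ i, (Obs.Y (D₁ i) - M.muXV S D₀ (Obs.X (D₁ i)) (Obs.V S (D₁ i))) ^ 2) / n

theorem psi1Hat_eq_riskDiff {m n : ℕ} (M : RegMethod g h m) {t : ℝ} {D₀ : Fin m → Obs g h}
    (D₁ : Fin n → Obs g h) {S : Finset (Fin h)} (hS : screenedHat D₀ t = S) :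
    psi1Hat M t D₀ D₁ = riskDiff M S D₀ D₁ := by
  subst hS; rfl

theorem measurable_riskDiff {m n : ℕ} (M : RegMethod g h m) (S : Finset (Fin h)) :
    Measurable fun p : (Fin m → Obs g h) × (Fin n → Obs g h) => riskDiff M S p.1 p.2 := by
  have hu (i : Fin n) : Measurable fun q : (Fin m → Obs g h) × (Fin n → Obs g h) => q.2 i := by
    fun_prop
  have h1 (i : Fin n) : Measurable fun q : (Fin m → Obs g h) × (Fin n → Obs g h) =>
      M.muV S q.1 (Obs.V S (q.2 i)) :=
    (M.measurable_muV S).comp (measurable_fst.prodMk ((Obs.measurable_V S).comp (hu i)))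
  have h2 (i : Fin n) : Measurable fun q : (Fin m → Obs g h) × (Fin n → Obs g h) =>
      M.muXV S q.1 (Obs.X (q.2 i)) (Obs.V S (q.2 i)) :=
    (M.measurable_muXV S).comp (measurable_fst.prodMk ((Obs.measurable_XV S).comp (hu i)))
  have h3 (i : Fin n) : Measurable fun q : (Fin m → Obs g h) × (Fin n → Obs g h) =>
      Obs.Y (q.2 i) := Obs.measurable_Y.comp (hu i)
  unfold riskDiff
  fun_prop

/-- The domain of the fitted functions varies with the selected set, so preimages are split over its
finitely many values. -/
theorem measurable_psi1Hat {m n : ℕ} (M : RegMethod g h m) (t : ℝ) :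
    Measurable fun p : (Fin m → Obs g h) × (Fin n → Obs g h) => psi1Hat M t p.1 p.2 := by
  intro s hs
  have : (fun p : (Fin m → Obs g h) × (Fin n → Obs g h) => psi1Hat M t p.1 p.2) ⁻¹' s
      = ⋃ S, (Prod.fst ⁻¹' {D | screenedHat D t = S}) ∩
        (fun p : (Fin m → Obs g h) × (Fin n → Obs g h) => riskDiff M S p.1 p.2) ⁻¹' s := by
    ext p
    simp only [Set.mem_preimage, Set.mem_iUnion, Set.mem_inter_iff, Set.mem_ofPred_eq,
      exists_eq_left']
    rw [psi1Hat_eq_riskDiff M p.2 rfl]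
  rw [this]
  exact MeasurableSet.iUnion fun S => (measurable_fst (measurableSet_screenedHat_eq t S)).inter
    (measurable_riskDiff M S hs)

end Asymptotics

end LOCO

/-! ### Asymptotic normality and nondegeneracy -/

theorem mainTheorem4 {g h : ℕ}
    {Ω : Type*} [MeasurableSpace Ω] (Pr : Measure Ω) [IsProbabilityMeasure Pr]
    (P : Measure (LOCO.Obs g h)) [IsProbabilityMeasure P]
    (U : ℕ → Ω → LOCO.Obs g h)
    (hU : ∀ i, Measurable (U i)) (hlaw : ∀ i, Pr.map (U i) = P) (hindep : iIndepFun U Pr)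
    (hX : ∀ i, MemLp (fun u => LOCO.Obs.X u i) 2 P)
    (hZ : ∀ j, MemLp (fun u => LOCO.Obs.Z u j) 2 P)
    (hY : MemLp LOCO.Obs.Y 4 P)
    (t : ℝ) (ht : ∀ j, LOCO.rho P j ≠ t)
    (m : ℕ → ℕ) (hm : Tendsto m atTop atTop)
    (M : (n : ℕ) → LOCO.RegMethod g h (m n))
    (hXV : LOCO.IsLittleOP Pr
      (fun n ω => LOCO.errXV (M n) P (LOCO.screened P t) (LOCO.trainSample U (m n) ω))
      (fun n => (n : ℝ) ^ (-(1 / 4) : ℝ)))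
    (hV : LOCO.IsLittleOP Pr
      (fun n ω => LOCO.errV (M n) P (LOCO.screened P t) (LOCO.trainSample U (m n) ω))
      (fun n => (n : ℝ) ^ (-(1 / 4) : ℝ)))
    (hψ : LOCO.psi1 P t ≠ 0) :
    TendstoInDistribution
      (fun (n : ℕ) (ω : Ω) => √(n : ℝ) *
        (LOCO.psi1Hat (M n) t (LOCO.trainSample U (m n) ω) (LOCO.evalSample U (m n) n ω)
          - LOCO.psi1 P t))
      atTop (id : ℝ → ℝ) (fun _ => Pr) (gaussianReal 0 (LOCO.tauSq P t).toNNReal) ∧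
    (¬ LOCO.Obs.Y =ᵐ[P] LOCO.regXV P (LOCO.screened P t) → 0 < LOCO.tauSq P t) := by
  have hXVm := LOCO.Obs.measurable_XV (g := g) (LOCO.screened P t)
  have hVm := LOCO.Obs.measurable_V (g := g) (LOCO.screened P t)
  have hBm : StronglyMeasurable[MeasurableSpace.comap (fun u : LOCO.Obs g h =>
      (LOCO.Obs.X u, LOCO.Obs.V (LOCO.screened P t) u)) inferInstance]
      (LOCO.regV P (LOCO.screened P t)) := by
    -- `V` is a projection of `(X, V)`, so it generates a smaller σ-algebra.
    refine (stronglyMeasurable_condExp (μ := P)).mono ?_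
    rintro _ ⟨s, hs, rfl⟩
    exact ⟨Prod.snd ⁻¹' s, measurable_snd hs, rfl⟩
  have hB4 : MemLp (LOCO.regV P (LOCO.screened P t)) 4 P := hY.condExp (by norm_num)
  refine ⟨?_, fun hne => LOCO.variance_riskIncrease_pos hXVm.comap_le hY hB4 hBm hψ hne⟩
  have hR1 := LOCO.tendstoInMeasure_excess_risk
    (fun n => LOCO.measurable_trainSample hU (m n)) (fun n => LOCO.measurable_evalSample hU (m n) n)
    (fun n => LOCO.indepFun_trainSample_evalSample hU hindep (m n) n)
    (fun n => LOCO.map_evalSample hU hlaw hindep (m n) n) LOCO.Obs.measurable_Y hY hXVm.comap_le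
    (fun n D u => (M n).muXV (LOCO.screened P t) D (LOCO.Obs.X u)
      (LOCO.Obs.V (LOCO.screened P t) u))
    (fun n => ((M n).measurable_muXV (LOCO.screened P t)).comp
      (measurable_fst.prodMk (hXVm.comp measurable_snd)))
    (fun n D => ((M n).measurable_muXV (LOCO.screened P t)).comp
      (measurable_const.prodMk (comap_measurable _))) hXV
  have hR2 := LOCO.tendstoInMeasure_excess_risk
    (fun n => LOCO.measurable_trainSample hU (m n)) (fun n => LOCO.measurable_evalSample hU (m n) n)
    (fun n => LOCO.indepFun_trainSample_evalSample hU hindep (m n) n)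
    (fun n => LOCO.map_evalSample hU hlaw hindep (m n) n) LOCO.Obs.measurable_Y hY hVm.comap_le
    (fun n D u => (M n).muV (LOCO.screened P t) D (LOCO.Obs.V (LOCO.screened P t) u))
    (fun n => ((M n).measurable_muV (LOCO.screened P t)).comp
      (measurable_fst.prodMk (hVm.comp measurable_snd)))
    (fun n D => ((M n).measurable_muV (LOCO.screened P t)).comp
      (measurable_const.prodMk (comap_measurable _))) hV
  have hAm' : Measurable (LOCO.regXV P (LOCO.screened P t)) :=
    stronglyMeasurable_condExp.measurable.mono hXVm.comap_le le_rfl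
  have hBm' : Measurable (LOCO.regV P (LOCO.screened P t)) :=
    stronglyMeasurable_condExp.measurable.mono hVm.comap_le le_rfl
  have hclt := LOCO.tendstoInDistribution_evalSample hU hlaw hindep m
    (W := fun u => (LOCO.Obs.Y u - LOCO.regV P (LOCO.screened P t) u) ^ 2
      - (LOCO.Obs.Y u - LOCO.regXV P (LOCO.screened P t) u) ^ 2)
    (((LOCO.Obs.measurable_Y.sub hBm').pow_const 2).sub
      ((LOCO.Obs.measurable_Y.sub hAm').pow_const 2))
    (LOCO.memLp_riskIncrease hY hB4)
  have hmean : ∫ u, ((LOCO.Obs.Y u - LOCO.regV P (LOCO.screened P t) u) ^ 2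
      - (LOCO.Obs.Y u - LOCO.regXV P (LOCO.screened P t) u) ^ 2) ∂P = LOCO.psi1 P t :=
    LOCO.integral_riskIncrease hXVm.comap_le hY hB4 hBm
  rw [hmean] at hclt
  -- Slutsky: only the distance to the central limit term has to vanish in probability.
  refine tendstoInDistribution_of_tendstoInMeasure_sub _ _ hclt ?_ fun n =>
    (((LOCO.measurable_psi1Hat (M n) t).comp ((LOCO.measurable_trainSample hU (m n)).prodMk
      (LOCO.measurable_evalSample hU (m n) n))).sub_const _).const_mul _ |>.aemeasurable
  rw [tendstoInMeasure_iff_norm] at hR1 hR2 ⊢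
  intro e he
  have hs := LOCO.tendsto_measure_screenedHat_ne hU hlaw hindep hX hZ ht hm
  have hsum := ((hR1 (e / 2) (half_pos he)).add (hR2 (e / 2) (half_pos he))).add hs
  simp only [add_zero] at hsum
  refine tendsto_of_tendsto_of_tendsto_of_le_of_le tendsto_const_nhds hsum (fun _ => zero_le)
    fun n => ?_
  -- A deviation of at least `e` forces one excess risk to reach `e / 2` or the screening to fail.
  refine (measure_mono ?_).trans ((measure_union_le _ _).trans
    (add_le_add (measure_union_le _ _) le_rfl))
  intro ω hω
  by_contra hcon
  simp only [Set.mem_union, Set.mem_ofPred_eq, not_or, not_le, not_not, Pi.zero_apply,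
    sub_zero, Pi.sub_apply] at hcon hω
  obtain ⟨⟨h1, h2⟩, h3⟩ := hcon
  -- Both identities also hold at `n = 0`, where division by zero makes all sides `0`.
  have hn : √(n : ℝ) / n = (√(n : ℝ))⁻¹ := by
    rw [← one_div]; exact Real.sqrt_div_self'
  have hn' : (√(n : ℝ))⁻¹ * n = √(n : ℝ) := by
    rw [inv_mul_eq_div]; exact Real.div_sqrt
  refine absurd hω (not_le.2 ?_)
  refine lt_of_eq_of_lt (congrArg _ ?_) ((norm_sub_le _ _).trans_lt (add_lt_add h2 h1)) |>.trans_eq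
    (add_halves e)
  simp only [LOCO.psi1Hat_eq_riskDiff _ _ h3, LOCO.riskDiff, LOCO.regV, LOCO.regXV,
    Finset.sum_sub_distrib]
  rw [mul_sub, mul_sub, mul_sub, ← mul_assoc, hn', mul_div_assoc', mul_div_assoc',
    mul_div_right_comm, mul_div_right_comm, hn]
  ring
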